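/- Let $\mathbb{F}_q$ be a finite field with $q$ elements, $\mathbf{A}=\mathbb{F}_q[T]$, $\mathbf{k}=\mathbb{F}_q(T)$, and let $\mathbf{k}^{\mathrm{alg}}$ be an algebraic closure of $\mathbf{k}$. Let $\tau(x)=x^q$, and let $C$, $a\mapsto C_a$, be the Carlitz module, i.e. the $\mathbb{F}_q$-algebra homomorphism from $\mathbf{A}$ to the twisted polynomial ring $\mathbf{k}\langle\tau\rangle$ (regarded as operators on $\mathbf{k}^{\mathrm{alg}}$) with $C_T=T+\tau$. Let $\wp\in\mathbf{A}$ be a monic prime, let $\Lambda_\wp=\{\lambda\in\mathbf{k}^{\mathrm{alg}} : C_\wp(\lambda)=0\}$, which is an $\mathbf{A}$-module via $a\cdot\lambda=C_a(\lambda)$, and let $\lambda_\wp$ be a generator of this module. Let $\mathbb{K}_\wp=\mathbf{k}(\Lambda_\wp)$ be the $\wp$-th cyclotomic function field and let $\mathcal{O}_\wp$ be the integral closure of $\mathbf{A}$ in $\mathbb{K}_\wp$. Let $\mathfrak{g}\in\mathbf{A}$ be a primitive root modulo $\wp$ (its class generates $(\mathbf{A}/\wp\mathbf{A})^\times$), and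 let $\sigma_{\mathfrak g}\in\mathrm{Gal}(\mathbb{K}_\wp/\mathbf{k})$ be the automorphism with $\sigma_{\mathfrak g}(\lambda_\wp)=C_{\mathfrak g}(\lambda_\wp)$. Let $\epsilon$ be a unit of $\mathcal{O}_\wp$ with $\mathrm{Norm}_{\mathbb{K}_\wp/\mathbf{k}}(\epsilon)=1$. Then there is a unique polynomial $P_\epsilon(x)\in\mathbf{A}[x]$ of degree at most $q^{\deg\wp}-2$ with $\epsilon=P_\epsilon(\lambda_\wp)$, and the following are equivalent: (a) $\epsilon$ is a quotient of conjugate units, i.e. $\epsilon=\delta/\sigma(\delta)$ for some unit $\delta$ of $\mathcal{O}_\wp$ and some $\sigma\in\mathrm{Gal}(\mathbb{K}_\wp/\mathbf{k})$; (b) $\epsilon=\delta/\sigma_{\mathfrak g}(\delta)$ for some unit $\delta$ of $\mathcal{O}_\wp$; (c) $P_\epsilon(0)\equiv 1\pmod{\wp}$. -/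

import Mathlib

open Polynomial

noncomputable section

namespace CarlitzCyclotomic

variable (F : Type*) [Field F] [Fintype F]

/-- The algebraic closure `k^alg` of the rational function field `k = F(T)`,
where `F` is a finite field with `q` elements. The polynomial ring `A = F[T]` is `F[X]`. -/
abbrev KAlg : Type _ := AlgebraicClosure (RatFunc F)

/-- The `q`-power map `τ(x) = x ^ q` on `k^alg`, as an `F`-linear endomorphism. -/
def tau : Module.End F (KAlg F) := (FiniteField.frobeniusAlgHom F (KAlg F)).toLinearMap

/-- The Carlitz module `a ↦ C_a`: the `F`-algebra homomorphism from `A = F[T]` with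
`C_T = T + τ`, where twisted polynomials `∑ c_i τ ^ i` are regarded as the operators
`x ↦ ∑ c_i x ^ (q ^ i)` on `k^alg`, and multiplication is composition. Thus
`carlitz F a x` is the value `C_a(x)`. -/
def carlitz : F[X] →ₐ[F] Module.End F (KAlg F) :=
  aeval (Algebra.lmul F (KAlg F) (algebraMap F[X] (KAlg F) X) + tau F)

theorem carlitz_X (x : KAlg F) :
    carlitz F X x = algebraMap F[X] (KAlg F) X * x + x ^ Fintype.card F := by
  simp [carlitz, tau]

theorem carlitz_C (c : F) (x : KAlg F) : carlitz F (C c) x = c • x := by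
  simp [carlitz, Algebra.algebraMap_eq_smul_one]

variable {F}

/-- The set `Λ_m` of `m`-torsion points of the Carlitz module. -/
def torsion (m : F[X]) : Set (KAlg F) := {x | carlitz F m x = 0}

/-- `l` is a primitive `m`-th root of `C`: an element of `Λ_m` that generates the `A`-module
`Λ_m`, on which `a ∈ A` acts as `C_a`. -/
def IsPrimitiveTorsion (m : F[X]) (l : KAlg F) : Prop :=
  l ∈ torsion m ∧ ∀ x ∈ torsion m, ∃ a : F[X], carlitz F a l = x

/-- The `m`-th cyclotomic function field `K_m = k(Λ_m)`. -/
abbrev cyclotomicField (m : F[X]) : IntermediateField (RatFunc F) (KAlg F) :=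
  IntermediateField.adjoin (RatFunc F) (torsion m)

/-- The ring of integers `O_m` of `K_m`: the integral closure of `A = F[T]` in `K_m`. -/
abbrev integers (m : F[X]) : Subalgebra F[X] (cyclotomicField m) :=
  FunctionField.ringOfIntegers F (cyclotomicField m)

/-- `g` is a primitive root modulo `m`: its class generates the group `(A / mA)ˣ`. -/
def IsPrimitiveRootMod (m g : F[X]) : Prop :=
  ∃ u : (F[X] ⧸ Ideal.span {m})ˣ,
    (u : F[X] ⧸ Ideal.span {m}) = Ideal.Quotient.mk (Ideal.span {m}) g ∧
      ∀ v : (F[X] ⧸ Ideal.span {m})ˣ, v ∈ Subgroup.zpowers u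

/-- `P` is a polynomial representing `α ∈ O_m` with respect to `l`: it has coefficients in `A`,
degree at most `q ^ deg m - 2`, and satisfies `α = P(l)`. -/
def Represents (m : F[X]) (l : KAlg F) (P : F[X][X]) (α : integers m) : Prop :=
  P.natDegree ≤ Fintype.card F ^ m.natDegree - 2 ∧
    aeval l P = ((α : cyclotomicField m) : KAlg F)

end CarlitzCyclotomic

end

/-! Put N = q^deg(w) - 1 and let l generate the w-torsion. The nonzero torsion points are the roots
of C_w(X)/X, whose constant term is w, and any two of them divide each other. Hence w is l^N up to a
unit, C_w(X)/X is Eisenstein at w, and the ring of integers is A[l] (`mem_adjoin_of_isIntegral`).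
Modulo l an element P(l) reduces to P(0), and A meets the multiples of l exactly in wA, so condition
(c) says that ε is 1 modulo l.

If ε = δ/τ(δ), then ε is 1 modulo l because every τ fixes A and sends l to a multiple of l, so it
acts trivially modulo l.

Conversely, let σ send l to C_g(l); it generates the Galois group. Hilbert 90 gives ε = y/σ(y) with
y integral. The ideal of y is Galois invariant and only w ramifies, so y = l^j b d with b in A and d
a unit (`exists_isIntegralUnit_div`). With c = σ(l)/l, which is g modulo l, this gives ε c^j σ(d) =
d. Reducing modulo l yields g^j = 1 modulo w, so N divides j. Then l^j is a power of w times a unit,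
and factors from A cancel in y/σ(y), which leaves a quotient of units.

Ideals are avoided throughout: "s divides r" is expressed as integrality of the quotient r/s over A.
-/

noncomputable section

namespace CarlitzCyclotomic

/-! ### Carlitz polynomials over A and the quotient C_a(X)/X -/

section CarlitzPolynomial

variable (F : Type*) [Field F] [Fintype F]

/-- The polynomial `C_{T ^ n}(x)` with coefficients in `A = F[T]`. -/
def carlitzPolyXPow : ℕ → F[X][X]
  | 0 => X
  | n + 1 => C X * carlitzPolyXPow n + carlitzPolyXPow n ^ Fintype.card F

variable {F}

/-- The polynomial `C_a(x)` with coefficients in `A = F[T]`. -/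
def carlitzPoly (a : F[X]) : F[X][X] :=
  ∑ i ∈ Finset.range (a.natDegree + 1), C (C (a.coeff i)) * carlitzPolyXPow F i

theorem aeval_carlitzPolyXPow (n : ℕ) (x : KAlg F) :
    aeval x (carlitzPolyXPow F n) = carlitz F (X ^ n) x := by
  induction n with
  | zero => simp [carlitzPolyXPow]
  | succ n ih =>
    rw [pow_succ', map_mul, Module.End.mul_apply, carlitz_X, ← ih]
    simp [carlitzPolyXPow]

theorem aeval_carlitzPoly (a : F[X]) (x : KAlg F) :
    aeval x (carlitzPoly a) = carlitz F a x := by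
  conv_rhs => rw [a.as_sum_range_C_mul_X_pow]
  simp only [carlitzPoly, map_sum, map_mul, LinearMap.sum_apply, Module.End.mul_apply,
    carlitz_C, aeval_C, aeval_carlitzPolyXPow]
  refine Finset.sum_congr rfl fun i _ => ?_
  rw [Algebra.smul_def, IsScalarTower.algebraMap_apply F F[X] (KAlg F)]
  rfl

theorem cast_card_eq_zero : ((Fintype.card F : ℕ) : F[X]) = 0 := by
  rw [← map_natCast (C : F →+* F[X]), FiniteField.cast_card_eq_zero, map_zero]

theorem derivative_carlitzPolyXPow (n : ℕ) :
    derivative (carlitzPolyXPow F n) = C (X ^ n) := by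
  induction n with
  | zero => simp [carlitzPolyXPow]
  | succ n ih =>
    have h : ((Fintype.card F : ℕ) : F[X]) = 0 := cast_card_eq_zero
    simp [carlitzPolyXPow, derivative_pow, ih, h, pow_succ']

/-- Only the linear term survives, since q = 0 in F. The constancy of this derivative yields the
constant term of C_a(X)/X, separability, and the discriminant. -/
theorem derivative_carlitzPoly (a : F[X]) : derivative (carlitzPoly a) = C a := by
  conv_rhs => rw [a.as_sum_range_C_mul_X_pow]
  simp [carlitzPoly, derivative_carlitzPolyXPow]

theorem coeff_zero_carlitzPolyXPow (n : ℕ) : (carlitzPolyXPow F n).coeff 0 = 0 := by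
  induction n with
  | zero => simp [carlitzPolyXPow]
  | succ n ih =>
    rw [coeff_zero_eq_eval_zero] at ih ⊢
    simp [carlitzPolyXPow, ih]

theorem coeff_zero_carlitzPoly (a : F[X]) : (carlitzPoly a).coeff 0 = 0 := by
  simp [carlitzPoly, coeff_zero_carlitzPolyXPow]

theorem carlitzPolyXPow_natDegree_monic (n : ℕ) :
    (carlitzPolyXPow F n).natDegree = Fintype.card F ^ n ∧ (carlitzPolyXPow F n).Monic := by
  have hq : 1 < Fintype.card F := Fintype.one_lt_card
  induction n with
  | zero => simp [carlitzPolyXPow, monic_X]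
  | succ n ih =>
    obtain ⟨h1, h2⟩ := ih
    have hlt : (C X * carlitzPolyXPow F n).natDegree
        < (carlitzPolyXPow F n ^ Fintype.card F).natDegree := by
      rw [h2.natDegree_pow, h1]
      refine (natDegree_C_mul_le _ _).trans_lt ?_
      rw [h1]
      have : 0 < Fintype.card F ^ n := by positivity
      nlinarith
    refine ⟨?_, ?_⟩
    · rw [carlitzPolyXPow, natDegree_add_eq_right_of_natDegree_lt hlt, h2.natDegree_pow, h1,
        pow_succ']
    · rw [carlitzPolyXPow]
      exact (h2.pow _).add_of_right (degree_lt_degree hlt)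

theorem carlitzPoly_natDegree_monic {a : F[X]} (ha : a.Monic) :
    (carlitzPoly a).natDegree = Fintype.card F ^ a.natDegree ∧ (carlitzPoly a).Monic := by
  have hq : 1 < Fintype.card F := Fintype.one_lt_card
  obtain ⟨h1, h2⟩ := carlitzPolyXPow_natDegree_monic (F := F) a.natDegree
  rw [carlitzPoly, Finset.sum_range_succ, coeff_natDegree, ha.leadingCoeff, map_one, map_one,
    one_mul]
  have hlt : (∑ i ∈ Finset.range a.natDegree, C (C (a.coeff i)) * carlitzPolyXPow F i).degree
      < (carlitzPolyXPow F a.natDegree).degree := by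
    rw [degree_eq_natDegree h2.ne_zero, h1]
    refine (degree_sum_le _ _).trans_lt ?_
    rw [Finset.sup_lt_iff (WithBot.bot_lt_coe _)]
    intro i hi
    refine (degree_le_natDegree.trans (Nat.cast_le.2 (natDegree_C_mul_le _ _))).trans_lt ?_
    rw [(carlitzPolyXPow_natDegree_monic i).1]
    exact_mod_cast Nat.pow_lt_pow_right hq (Finset.mem_range.1 hi)
  exact ⟨by rw [natDegree_add_eq_right_of_degree_lt hlt, h1], h2.add_of_right hlt⟩

/-- The polynomial `C_a(x) / x`. -/
def carlitzQuot (a : F[X]) : F[X][X] := divX (carlitzPoly a)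

theorem X_mul_carlitzQuot (a : F[X]) : X * carlitzQuot a = carlitzPoly a := by
  have := X_mul_divX_add (carlitzPoly a)
  rwa [coeff_zero_carlitzPoly, map_zero, add_zero] at this

theorem eval_zero_carlitzQuot (a : F[X]) : (carlitzQuot a).eval 0 = a := by
  have := congrArg (eval 0) (derivative_carlitzPoly a)
  rw [← X_mul_carlitzQuot] at this
  simpa using this

theorem carlitzQuot_natDegree_monic {a : F[X]} (ha : a.Monic) :
    (carlitzQuot a).natDegree = Fintype.card F ^ a.natDegree - 1 ∧ (carlitzQuot a).Monic := by
  obtain ⟨h1, h2⟩ := carlitzPoly_natDegree_monic ha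
  refine ⟨by rw [carlitzQuot, natDegree_divX_eq_natDegree_tsub_one, h1], ?_⟩
  rw [← X_mul_carlitzQuot] at h2
  exact monic_X.of_mul_monic_left h2

theorem mul_aeval_carlitzQuot (a : F[X]) (x : KAlg F) :
    x * aeval x (carlitzQuot a) = carlitz F a x := by
  rw [← aeval_carlitzPoly, ← X_mul_carlitzQuot, map_mul, aeval_X]

theorem X_mul_derivative_carlitzQuot (a : F[X]) :
    carlitzQuot a + X * derivative (carlitzQuot a) = C a := by
  rw [← derivative_carlitzPoly, ← X_mul_carlitzQuot, derivative_mul, derivative_X, one_mul]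

end CarlitzPolynomial

/-! ### Integrality of products of quotients, and descent of divisibility to A -/

section Generalities

theorem isIntegral_aeval {R A : Type*} [CommRing R] [CommRing A] [Algebra R A] {x : A}
    (hx : IsIntegral R x) (P : R[X]) : IsIntegral R (aeval x P) :=
  adjoin_le_integralClosure hx (aeval_mem_adjoin_singleton _ _)

theorem isIntegral_prod_div {R K : Type*} [CommRing R] [Field K] [Algebra R K]
    {s : Multiset K} {x : K}
    (h : ∀ r ∈ s, IsIntegral R (r / x)) : IsIntegral R (s.prod / x ^ s.card) := by
  induction s using Multiset.induction with
  | empty => simpa using isIntegral_one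
  | cons a s ih =>
    rw [Multiset.prod_cons, Multiset.card_cons, pow_succ', mul_div_mul_comm]
    exact (h a (Multiset.mem_cons_self _ _)).mul
      (ih fun r hr => h r (Multiset.mem_cons_of_mem hr))

theorem isIntegral_div_prod {R K : Type*} [CommRing R] [Field K] [Algebra R K]
    {s : Multiset K} {x : K}
    (h : ∀ r ∈ s, IsIntegral R (x / r)) : IsIntegral R (x ^ s.card / s.prod) := by
  induction s using Multiset.induction with
  | empty => simpa using isIntegral_one
  | cons a s ih =>
    rw [Multiset.prod_cons, Multiset.card_cons, pow_succ', mul_div_mul_comm]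
    exact (h a (Multiset.mem_cons_self _ _)).mul
      (ih fun r hr => h r (Multiset.mem_cons_of_mem hr))

variable {F : Type*} [Field F]

theorem algebraMap_KAlg_injective : Function.Injective (algebraMap F[X] (KAlg F)) :=
  FunctionField.algebraMap_injective F (KAlg F)

/-- The quotient lies in F(T), and A is integrally closed there. -/
theorem dvd_of_isIntegral_div {K : Type*} [Field K] [Algebra (RatFunc F) K] [Algebra F[X] K]
    [IsScalarTower F[X] (RatFunc F) K] {a b : F[X]} (hb : b ≠ 0)
    (h : IsIntegral F[X] (algebraMap F[X] K a / algebraMap F[X] K b)) : b ∣ a := by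
  rw [IsScalarTower.algebraMap_apply F[X] (RatFunc F) K a,
    IsScalarTower.algebraMap_apply F[X] (RatFunc F) K b, ← map_div₀,
    isIntegral_algebraMap_iff (algebraMap (RatFunc F) K).injective] at h
  obtain ⟨c, hc⟩ := IsIntegrallyClosed.isIntegral_iff.1 h
  have hb' : algebraMap F[X] (RatFunc F) b ≠ 0 :=
    (map_ne_zero_iff _ (IsFractionRing.injective _ _)).2 hb
  rw [eq_div_iff hb', ← map_mul] at hc
  exact ⟨c, by rw [mul_comm]; exact (IsFractionRing.injective _ _ hc).symm⟩

end Generalities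

/-! ### Torsion points: mutual divisibility, w as their product, Eisenstein property -/

section Torsion

variable {F : Type*} [Field F] [Fintype F]

theorem carlitz_mul (a b : F[X]) (x : KAlg F) :
    carlitz F (a * b) x = carlitz F a (carlitz F b x) := by
  rw [map_mul, Module.End.mul_apply]

theorem carlitz_add (a b : F[X]) (x : KAlg F) :
    carlitz F (a + b) x = carlitz F a x + carlitz F b x := by
  rw [map_add, LinearMap.add_apply]

theorem carlitz_mem_torsion {m : F[X]} {x : KAlg F} (hx : x ∈ torsion m) (a : F[X]) :
    carlitz F a x ∈ torsion m := by
  have hx' : carlitz F m x = 0 := hx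
  change carlitz F m (carlitz F a x) = 0
  rw [← carlitz_mul, mul_comm, carlitz_mul, hx', map_zero]

theorem carlitz_eq_zero_of_dvd {m a : F[X]} {x : KAlg F} (hx : x ∈ torsion m) (h : m ∣ a) :
    carlitz F a x = 0 := by
  obtain ⟨b, rfl⟩ := h
  rw [mul_comm, carlitz_mul, show carlitz F m x = 0 from hx, map_zero]

theorem carlitz_congr {m a b : F[X]} {x : KAlg F} (hx : x ∈ torsion m) (h : m ∣ a - b) :
    carlitz F a x = carlitz F b x := by
  have := carlitz_eq_zero_of_dvd hx h
  rwa [map_sub, LinearMap.sub_apply, sub_eq_zero] at this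

theorem isIntegral_of_mem_torsion {m : F[X]} (hm : m.Monic) {x : KAlg F} (hx : x ∈ torsion m) :
    IsIntegral F[X] x :=
  ⟨carlitzPoly m, (carlitzPoly_natDegree_monic hm).2, by
    rw [← aeval_def, aeval_carlitzPoly]; exact hx⟩

theorem separable_map_carlitzPoly {m : F[X]} {K : Type*} [Field K] [Algebra F[X] K]
    (hK : algebraMap F[X] K m ≠ 0) : ((carlitzPoly m).map (algebraMap F[X] K)).Separable := by
  rw [separable_def, derivative_map, derivative_carlitzPoly, map_C]
  obtain ⟨u, hu⟩ := (isUnit_C (R := K)).2 hK.isUnit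
  exact ⟨0, ↑u⁻¹, by rw [← hu]; simp⟩

variable {w : F[X]} {l : KAlg F}

/-- A zero generator would leave only the torsion point 0, but C_w(X)/X has positive degree and
nonzero constant term w, hence a nonzero root. -/
theorem primitive_ne_zero (hw : w.Monic) (hp : Prime w) (hl : IsPrimitiveTorsion w l) : l ≠ 0 := by
  rintro rfl
  have hd : 0 < w.natDegree := hw.natDegree_pos_of_not_isUnit hp.not_isUnit
  have hq : 1 < Fintype.card F := Fintype.one_lt_card
  obtain ⟨h1, h2⟩ := carlitzQuot_natDegree_monic hw
  have hN : 1 < Fintype.card F ^ w.natDegree := Nat.one_lt_pow hd.ne' hq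
  obtain ⟨x, hx⟩ := IsAlgClosed.exists_aeval_eq_zero_of_injective (KAlg F) (R := F[X])
    algebraMap_KAlg_injective (carlitzQuot w) (by
      rw [degree_eq_natDegree h2.ne_zero, h1]; exact_mod_cast (by omega))
  have hxt : x ∈ torsion w := by
    change carlitz F w x = 0
    rw [← mul_aeval_carlitzQuot, hx, mul_zero]
  obtain ⟨a, ha⟩ := hl.2 x hxt
  rw [map_zero] at ha
  subst ha
  rw [aeval_def, eval₂_at_zero] at hx
  have := (map_eq_zero_iff _ algebraMap_KAlg_injective).1 hx
  rw [coeff_zero_eq_eval_zero, eval_zero_carlitzQuot] at this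
  exact hp.ne_zero this

theorem carlitz_eq_zero_iff (hw : w.Monic) (hp : Prime w) (hl : IsPrimitiveTorsion w l)
    (a : F[X]) : carlitz F a l = 0 ↔ w ∣ a := by
  refine ⟨fun h => ?_, carlitz_eq_zero_of_dvd hl.1⟩
  by_contra hwa
  obtain ⟨u, v, huv⟩ := (hp.irreducible.coprime_iff_not_dvd.2 hwa)
  apply primitive_ne_zero hw hp hl
  have h2 : carlitz F (u * w + v * a) l = l := by
    rw [huv, map_one, Module.End.one_apply]
  have h3 : carlitz F w l = 0 := hl.1
  rw [← h2, carlitz_add, carlitz_mul, carlitz_mul, h, h3, map_zero, map_zero, add_zero]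

theorem isIntegral_carlitz_div {m : F[X]} (hm : m.Monic) {x : KAlg F} (hx : x ∈ torsion m)
    (h0 : x ≠ 0) (a : F[X]) : IsIntegral F[X] (carlitz F a x / x) := by
  rw [← mul_aeval_carlitzQuot, mul_div_cancel_left₀ _ h0]
  exact isIntegral_aeval (isIntegral_of_mem_torsion hm hx) _

/-- If r = C_a(l) and v inverts a modulo w, then l = C_v(r); both quotients are then values of
polynomials C_a(X)/X and C_v(X)/X at integral points. -/
theorem isIntegral_div_of_mem_torsion (hw : w.Monic) (hp : Prime w) (hl : IsPrimitiveTorsion w l)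
    {r : KAlg F} (hr : r ∈ torsion w) (h0 : r ≠ 0) :
    IsIntegral F[X] (r / l) ∧ IsIntegral F[X] (l / r) := by
  obtain ⟨a, rfl⟩ := hl.2 r hr
  refine ⟨isIntegral_carlitz_div hw hl.1 (primitive_ne_zero hw hp hl) a, ?_⟩
  have hwa : ¬ w ∣ a := fun h => h0 ((carlitz_eq_zero_iff hw hp hl a).2 h)
  obtain ⟨u, v, huv⟩ := (hp.irreducible.coprime_iff_not_dvd.2 hwa)
  have h : carlitz F v (carlitz F a l) = l := by
    rw [← carlitz_mul]
    have := carlitz_congr hl.1 (a := v * a) (b := 1) ⟨-u, by linear_combination huv⟩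
    rwa [map_one, Module.End.one_apply] at this
  have := isIntegral_carlitz_div hw hr h0 v
  rwa [h] at this

theorem mem_torsion_iff (x : KAlg F) : x ∈ torsion w ↔ x = 0 ∨ aeval x (carlitzQuot w) = 0 := by
  rw [← mul_eq_zero, mul_aeval_carlitzQuot]; rfl

theorem aeval_primitive_carlitzQuot (hw : w.Monic) (hp : Prime w) (hl : IsPrimitiveTorsion w l) :
    aeval l (carlitzQuot w) = 0 :=
  ((mem_torsion_iff l).1 hl.1).resolve_left (primitive_ne_zero hw hp hl)

theorem mem_aroots_carlitzQuot (hp : Prime w) {r : KAlg F}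
    (hr : r ∈ (carlitzQuot w).aroots (KAlg F)) : r ∈ torsion w ∧ r ≠ 0 := by
  rw [mem_aroots'] at hr
  refine ⟨(mem_torsion_iff r).2 (.inr hr.2), ?_⟩
  rintro rfl
  have hx := hr.2
  rw [aeval_def, eval₂_at_zero] at hx
  have := (map_eq_zero_iff _ algebraMap_KAlg_injective).1 hx
  rw [coeff_zero_eq_eval_zero, eval_zero_carlitzQuot] at this
  exact hp.ne_zero this

theorem card_aroots_carlitzQuot (hw : w.Monic) :
    ((carlitzQuot w).aroots (KAlg F)).card = (carlitzQuot w).natDegree := by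
  rw [aroots, splits_iff_card_roots.1 (IsAlgClosed.splits _),
    (carlitzQuot_natDegree_monic hw).2.natDegree_map]

theorem algebraMap_prime_eq_prod (hw : w.Monic) :
    algebraMap F[X] (KAlg F) w = (-1) ^ (carlitzQuot w).natDegree *
      ((carlitzQuot w).aroots (KAlg F)).prod := by
  obtain ⟨-, h2⟩ := carlitzQuot_natDegree_monic hw
  have := (IsAlgClosed.splits ((carlitzQuot w).map
    (algebraMap F[X] (KAlg F)))).coeff_zero_eq_prod_roots_of_monic (h2.map _)
  rwa [coeff_map, coeff_zero_eq_eval_zero, eval_zero_carlitzQuot, h2.natDegree_map] at this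

theorem isIntegral_prime_div_pow (hw : w.Monic) (hp : Prime w) (hl : IsPrimitiveTorsion w l) :
    IsIntegral F[X] (algebraMap F[X] (KAlg F) w / l ^ (carlitzQuot w).natDegree) := by
  rw [algebraMap_prime_eq_prod hw, mul_div_assoc]
  refine (isIntegral_one.neg.pow _).mul ?_
  rw [← card_aroots_carlitzQuot hw]
  refine isIntegral_prod_div fun r hr => ?_
  obtain ⟨h1, h2⟩ := mem_aroots_carlitzQuot hp hr
  exact (isIntegral_div_of_mem_torsion hw hp hl h1 h2).1

theorem isIntegral_pow_div_prime (hw : w.Monic) (hp : Prime w) (hl : IsPrimitiveTorsion w l) :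
    IsIntegral F[X] (l ^ (carlitzQuot w).natDegree / algebraMap F[X] (KAlg F) w) := by
  rw [algebraMap_prime_eq_prod hw, ← one_mul (l ^ _), mul_div_mul_comm, one_div, ← inv_pow,
    inv_neg, inv_one]
  refine (isIntegral_one.neg.pow _).mul ?_
  rw [← card_aroots_carlitzQuot hw]
  refine isIntegral_div_prod fun r hr => ?_
  obtain ⟨h1, h2⟩ := mem_aroots_carlitzQuot hp hr
  exact (isIntegral_div_of_mem_torsion hw hp hl h1 h2).2

/-- Multiplying (c/l)^N by the integral element l^N/w shows that w divides c^N in A. -/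
theorem dvd_of_isIntegral_div_primitive (hw : w.Monic) (hp : Prime w)
    (hl : IsPrimitiveTorsion w l) {c : F[X]}
    (hc : IsIntegral F[X] (algebraMap F[X] (KAlg F) c / l)) : w ∣ c := by
  have h := (hc.pow (carlitzQuot w).natDegree).mul (isIntegral_pow_div_prime hw hp hl)
  have h0 : l ^ (carlitzQuot w).natDegree ≠ 0 := pow_ne_zero _ (primitive_ne_zero hw hp hl)
  rw [div_pow, div_mul_div_cancel₀ h0, ← map_pow] at h
  exact hp.dvd_of_dvd_pow (dvd_of_isIntegral_div hp.ne_zero h)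

theorem natDegree_carlitzQuot_pos (hw : w.Monic) (hp : Prime w) :
    0 < (carlitzQuot w).natDegree := by
  have hd : 0 < w.natDegree := hw.natDegree_pos_of_not_isUnit hp.not_isUnit
  have hq : 1 < Fintype.card F := Fintype.one_lt_card
  have hN : 1 < Fintype.card F ^ w.natDegree := Nat.one_lt_pow hd.ne' hq
  rw [(carlitzQuot_natDegree_monic hw).1]
  omega

theorem isEisensteinAt_carlitzQuot (hw : w.Monic) (hp : Prime w) (hl : IsPrimitiveTorsion w l) :
    (carlitzQuot w).IsEisensteinAt (Ideal.span {w}) := by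
  obtain ⟨-, h2⟩ := carlitzQuot_natDegree_monic hw
  refine ⟨?_, fun {n} hn => ?_, ?_⟩
  · rw [h2.leadingCoeff, Ideal.mem_span_singleton]
    exact fun h => hp.not_isUnit (isUnit_of_dvd_one h)
  · rw [Ideal.mem_span_singleton]
    apply dvd_of_isIntegral_div_primitive hw hp hl
    -- A non-leading coefficient is, up to sign, a sum of products of at least one root, and every
    -- root is a multiple of l.
    have hv := coeff_eq_esymm_roots_of_card (p := (carlitzQuot w).map (algebraMap F[X] (KAlg F)))
      (by rw [h2.natDegree_map]; exact card_aroots_carlitzQuot hw) (k := n)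
      (by rw [h2.natDegree_map]; exact hn.le)
    rw [coeff_map, (h2.map _).leadingCoeff, one_mul, h2.natDegree_map] at hv
    rw [hv, mul_div_assoc]
    refine (isIntegral_one.neg.pow _).mul ?_
    rw [Multiset.esymm, ← Multiset.sum_map_div]
    refine IsIntegral.multiset_sum fun x hx => ?_
    simp only [Multiset.mem_map, Multiset.mem_powersetCard] at hx
    obtain ⟨t, ⟨ht, htc⟩, rfl⟩ := hx
    obtain ⟨r, hr⟩ := Multiset.card_pos_iff_exists_mem.1 (show 0 < t.card by omega)
    obtain ⟨t', rfl⟩ := Multiset.exists_cons_of_mem hr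
    have hroot := fun r hr => mem_aroots_carlitzQuot hp (Multiset.mem_of_le ht (a := r) hr)
    simp only [Multiset.prod_cons]
    rw [mul_div_right_comm]
    obtain ⟨h3, h4⟩ := hroot r hr
    exact (isIntegral_div_of_mem_torsion hw hp hl h3 h4).1.mul (IsIntegral.multiset_prod
      fun y hy => isIntegral_of_mem_torsion hw (hroot y (Multiset.mem_cons_of_mem hy)).1)
  · rw [coeff_zero_eq_eval_zero, eval_zero_carlitzQuot, Ideal.span_singleton_pow,
      Ideal.mem_span_singleton, sq]
    rintro ⟨c, hc⟩
    apply hp.not_isUnit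
    refine .of_mul_eq_one c (mul_left_cancel₀ hp.ne_zero ?_)
    rw [mul_one, ← mul_assoc, ← hc]

theorem irreducible_carlitzQuot (hw : w.Monic) (hp : Prime w) (hl : IsPrimitiveTorsion w l) :
    Irreducible (carlitzQuot w) :=
  (isEisensteinAt_carlitzQuot hw hp hl).irreducible
    ((Ideal.span_singleton_prime hp.ne_zero).2 hp)
    (carlitzQuot_natDegree_monic hw).2.isPrimitive (natDegree_carlitzQuot_pos hw hp)

end Torsion

/-! ### Units of an integral closure, viewed as field elements -/

section IntegralUnits

/-- An element of a field `K` over `R` which is a unit of the integral closure of `R` in `K`. -/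
structure IsIntegralUnit (R : Type*) {K : Type*} [CommRing R] [Field K] [Algebra R K] (x : K) :
    Prop where
  ne_zero : x ≠ 0
  isIntegral : IsIntegral R x
  isIntegral_inv : IsIntegral R x⁻¹

namespace IsIntegralUnit

variable {R K : Type*} [CommRing R] [Field K] [Algebra R K] {x y : K}

theorem one : IsIntegralUnit R (1 : K) :=
  ⟨one_ne_zero, isIntegral_one, by rw [inv_one]; exact isIntegral_one⟩

theorem inv (hx : IsIntegralUnit R x) : IsIntegralUnit R x⁻¹ :=
  ⟨inv_ne_zero hx.ne_zero, hx.isIntegral_inv, by rw [inv_inv]; exact hx.isIntegral⟩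

theorem mul (hx : IsIntegralUnit R x) (hy : IsIntegralUnit R y) : IsIntegralUnit R (x * y) :=
  ⟨mul_ne_zero hx.ne_zero hy.ne_zero, hx.isIntegral.mul hy.isIntegral, by
    rw [mul_inv]; exact hx.isIntegral_inv.mul hy.isIntegral_inv⟩

theorem div (hx : IsIntegralUnit R x) (hy : IsIntegralUnit R y) : IsIntegralUnit R (x / y) := by
  rw [div_eq_mul_inv]; exact hx.mul hy.inv

theorem pow (hx : IsIntegralUnit R x) (n : ℕ) : IsIntegralUnit R (x ^ n) :=
  ⟨pow_ne_zero _ hx.ne_zero, hx.isIntegral.pow n, by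
    rw [← inv_pow]; exact hx.isIntegral_inv.pow n⟩

theorem of_pow {n : ℕ} (hn : 0 < n) (hx : IsIntegralUnit R (x ^ n)) : IsIntegralUnit R x :=
  ⟨ne_zero_pow hn.ne' hx.ne_zero, hx.isIntegral.of_pow hn,
    IsIntegral.of_pow hn (by rw [inv_pow]; exact hx.isIntegral_inv)⟩

theorem map (hx : IsIntegralUnit R x) {L : Type*} [Field L] [Algebra R L] (f : K →ₐ[R] L) :
    IsIntegralUnit R (f x) :=
  ⟨(map_ne_zero f).2 hx.ne_zero, hx.isIntegral.map f, by
    rw [← map_inv₀]; exact hx.isIntegral_inv.map f⟩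

theorem prod {ι : Type*} {s : Finset ι} {f : ι → K} (h : ∀ i ∈ s, IsIntegralUnit R (f i)) :
    IsIntegralUnit R (∏ i ∈ s, f i) :=
  Finset.prod_induction f (IsIntegralUnit R) (fun _ _ h1 h2 => h1.mul h2) one h

theorem algebraMap_of_isUnit {r : R} (hr : IsUnit r) : IsIntegralUnit R (algebraMap R K r) := by
  obtain ⟨u, rfl⟩ := hr
  have h : algebraMap R K ↑u * algebraMap R K ↑u⁻¹ = 1 := by rw [← map_mul]; simp
  refine ⟨left_ne_zero_of_mul_eq_one h, isIntegral_algebraMap, ?_⟩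
  rw [inv_eq_of_mul_eq_one_right h]
  exact isIntegral_algebraMap

theorem of_unit (u : (integralClosure R K)ˣ) : IsIntegralUnit R ((u : integralClosure R K) : K) := by
  have h : ((u : integralClosure R K) : K) * ((↑u⁻¹ : integralClosure R K) : K) = 1 := by
    rw [← MulMemClass.coe_mul, Units.mul_inv, OneMemClass.coe_one]
  refine ⟨left_ne_zero_of_mul_eq_one h, (u : integralClosure R K).2, ?_⟩
  rw [inv_eq_of_mul_eq_one_right h]
  exact (↑u⁻¹ : integralClosure R K).2

theorem exists_unit (hx : IsIntegralUnit R x) :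
    ∃ u : (integralClosure R K)ˣ, ((u : integralClosure R K) : K) = x :=
  ⟨⟨⟨x, hx.isIntegral⟩, ⟨x⁻¹, hx.isIntegral_inv⟩, Subtype.ext (mul_inv_cancel₀ hx.ne_zero),
    Subtype.ext (inv_mul_cancel₀ hx.ne_zero)⟩, rfl⟩

end IsIntegralUnit

end IntegralUnits

/-! ### Descending an ideal to A when only one prime ramifies -/

section Descent

variable {F K : Type*} [Field F] [Field K] [Algebra F[X] K]

/-- This is the form in which p is unramified: A[x]/(p) is (A/p)[X] modulo the squarefree reduction
of f, hence reduced, so p divides z once it divides a power of z. -/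
theorem exists_eq_mul_of_pow_eq_mul {x : K} {f : F[X][X]} (hfx : aeval x f = 0)
    (hf : ∀ P : F[X][X], aeval x P = 0 → f ∣ P) {p : F[X]} (hp : Prime p)
    (hsq : Squarefree (f.map (Ideal.Quotient.mk (Ideal.span {p})))) {n : ℕ} {z y : K}
    (hz : z ∈ Algebra.adjoin F[X] {x}) (hy : y ∈ Algebra.adjoin F[X] {x})
    (h : z ^ n = algebraMap F[X] K p * y) :
    ∃ y' ∈ Algebra.adjoin F[X] {x}, z = algebraMap F[X] K p * y' := by
  have hmax : (Ideal.span {p}).IsMaximal :=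
    PrincipalIdealRing.isMaximal_of_irreducible hp.irreducible
  let _ := Ideal.Quotient.field (Ideal.span {p})
  rw [Algebra.adjoin_singleton_eq_range_aeval] at hz hy
  obtain ⟨Z, rfl⟩ := hz
  obtain ⟨Y, rfl⟩ := hy
  obtain ⟨G, hG⟩ := hf (Z ^ n - C p * Y) (by
    rw [map_sub, map_pow, map_mul, aeval_C, sub_eq_zero]; exact h)
  have hp0 : Ideal.Quotient.mk (Ideal.span {p}) p = 0 :=
    Ideal.Quotient.eq_zero_iff_mem.2 (Ideal.mem_span_singleton_self p)
  have h1 : f.map (Ideal.Quotient.mk (Ideal.span {p})) ∣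
      Z.map (Ideal.Quotient.mk (Ideal.span {p})) ^ n :=
    ⟨G.map _, by
      have := congrArg (Polynomial.map (Ideal.Quotient.mk (Ideal.span {p}))) hG
      simpa [hp0] using this⟩
  obtain ⟨g, hg⟩ := hsq.isRadical n _ h1
  obtain ⟨g, rfl⟩ := map_surjective _ Ideal.Quotient.mk_surjective g
  have h2 : C p ∣ Z - f * g := by
    rw [C_dvd_iff_dvd_coeff]
    intro i
    rw [← Ideal.mem_span_singleton, ← Ideal.Quotient.eq_zero_iff_mem, ← coeff_map,
      Polynomial.map_sub, Polynomial.map_mul, hg, sub_self, coeff_zero]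
  obtain ⟨V, hV⟩ := h2
  refine ⟨aeval x V, aeval_mem_adjoin_singleton _ _, ?_⟩
  have := congrArg (aeval x) hV
  rw [map_sub, map_mul, hfx, zero_mul, sub_zero, map_mul, aeval_C] at this
  exact this

variable [Algebra (RatFunc F) K] [IsScalarTower F[X] (RatFunc F) K]

/-- If the ideal of `a` is, up to an exponent `N`, the extension of an ideal of `A`, and if
`w` is the only ramified prime, with `w = x ^ N` up to a unit, then the ideal of `a` is the
product of a power of `x` and an ideal of `A`. -/
theorem exists_isIntegralUnit_div {x : K} {N : ℕ} (hN : 0 < N) {w : F[X]} (hw : Prime w)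
    (hx : IsIntegralUnit F[X] (algebraMap F[X] K w / x ^ N))
    (hunr : ∀ p : F[X], Prime p → ¬ p ∣ w → ∀ z y : K, IsIntegral F[X] z → IsIntegral F[X] y →
      z ^ N = algebraMap F[X] K p * y → ∃ y', IsIntegral F[X] y' ∧ z = algebraMap F[X] K p * y')
    (n : F[X]) (hn : n ≠ 0) (a : K) (ha : IsIntegral F[X] a)
    (h : IsIntegralUnit F[X] (a ^ N / algebraMap F[X] K n)) :
    ∃ (j : ℕ) (b : F[X]), b ≠ 0 ∧ IsIntegralUnit F[X] (a / (x ^ j * algebraMap F[X] K b)) := by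
  have hinj := FunctionField.algebraMap_injective F K
  have hne : ∀ {r : F[X]}, r ≠ 0 → algebraMap F[X] K r ≠ 0 := fun hr =>
    (map_ne_zero_iff _ hinj).2 hr
  have hx0 : x ≠ 0 := by
    rintro rfl
    exact hx.ne_zero (by rw [zero_pow hN.ne', div_zero])
  -- Induction on the degree of n, where n generates the ideal of a^N: a prime factor of n is
  -- removed at the cost of dividing a by x or by that prime.
  induction hd : n.natDegree using Nat.strong_induction_on generalizing n a with
  | _ d ih =>
  subst hd
  by_cases hu : IsUnit n
  · refine ⟨0, 1, one_ne_zero, ?_⟩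
    rw [pow_zero, map_one, one_mul, div_one]
    have := h.mul (IsIntegralUnit.algebraMap_of_isUnit hu)
    rw [div_mul_cancel₀ _ (hne hn)] at this
    exact this.of_pow hN
  obtain ⟨p, hp, n', rfl⟩ := WfDvdMonoid.exists_irreducible_factor hu hn
  have hp' := hp.prime
  have hn' : n' ≠ 0 := right_ne_zero_of_mul hn
  have hdeg : 0 < p.natDegree := hp.natDegree_pos
  by_cases hpw : p ∣ w
  -- Here p and w are associated. As w is x^N up to a unit, removing w from n corresponds to
  -- dividing a by x.
  · obtain ⟨c, hc⟩ := (hp.dvd_symm hw.irreducible hpw)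
    have hc0 : c ≠ 0 := by rintro rfl; exact hp'.ne_zero (by rw [hc, mul_zero])
    have hw1 : c * n' ≠ 0 := mul_ne_zero hc0 hn'
    have key : (a / x) ^ N / algebraMap F[X] K (c * n') =
        a ^ N / algebraMap F[X] K (p * n') * (algebraMap F[X] K w / x ^ N) := by
      have h1 := hne hw1
      have h2 := hne hn
      have h3 := hne hw.ne_zero
      rw [hc, mul_assoc w c n', map_mul _ w, div_pow]
      field_simp
    have hunit := h.mul hx
    rw [← key] at hunit
    have hint : IsIntegral F[X] (a / x) := by
      refine IsIntegral.of_pow hN ?_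
      have := hunit.isIntegral.mul (isIntegral_algebraMap (x := c * n'))
      rwa [div_mul_cancel₀ _ (hne hw1)] at this
    have hlt : (c * n').natDegree < (p * n').natDegree := by
      rw [hc, mul_assoc, natDegree_mul hw.ne_zero hw1]
      have := hw.irreducible.natDegree_pos
      omega
    obtain ⟨j, b, hb, hj⟩ := ih _ hlt (c * n') hw1 (a / x) hint hunit rfl
    refine ⟨j + 1, b, hb, ?_⟩
    rwa [pow_succ', mul_assoc, ← div_div]
  · obtain ⟨a', ha', rfl⟩ := hunr p hp' hpw a
      (a ^ N / algebraMap F[X] K (p * n') * algebraMap F[X] K n') ha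
      (h.isIntegral.mul isIntegral_algebraMap) (by
        have h2 := hne hn'
        have h3 := hne hp'.ne_zero
        rw [map_mul]
        field_simp)
    -- Since p divides a, the full power p^N divides n, so n loses p^N while a loses p.
    have hdvd : p ^ N ∣ p * n' := by
      refine dvd_of_isIntegral_div (K := K) (pow_ne_zero _ hp'.ne_zero) ?_
      have := (h.isIntegral_inv).mul (ha'.pow N)
      rw [inv_div, mul_pow, mul_comm (_ ^ N) (a' ^ N), div_mul_eq_mul_div,
        mul_comm _ (a' ^ N), mul_div_mul_left _ _ ?_] at this
      · rwa [map_pow]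
      · rintro h0
        exact h.ne_zero (by rw [mul_pow, h0, mul_zero, zero_div])
    obtain ⟨m, hm⟩ := hdvd
    have hm0 : m ≠ 0 := by rintro rfl; exact hn (by rw [hm, mul_zero])
    have hlt : m.natDegree < (p * n').natDegree := by
      rw [hm, natDegree_mul (pow_ne_zero _ hp'.ne_zero) hm0, natDegree_pow]
      have := Nat.mul_pos hN hdeg
      omega
    rw [hm, map_mul, map_pow, mul_pow,
      mul_div_mul_left _ _ (pow_ne_zero _ (hne hp'.ne_zero))] at h
    obtain ⟨j, b, hb, hj⟩ := ih _ hlt m hm0 a' ha' h rfl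
    refine ⟨j, p * b, mul_ne_zero hp'.ne_zero hb, ?_⟩
    rwa [map_mul, mul_left_comm, mul_div_mul_left _ _ (hne hp'.ne_zero)]

end Descent

/-! ### Hilbert's Theorem 90 for cyclic extensions -/

section HilbertNinety

variable {k K : Type*} [Field k] [Field K] [Algebra k K] [FiniteDimensional k K] [IsGalois k K]

theorem norm_eq_prod_range_of_zpowers {σ : K ≃ₐ[k] K}
    (hσ : ∀ τ, τ ∈ Subgroup.zpowers σ) (x : K) :
    algebraMap k K (Algebra.norm k x) = ∏ i ∈ Finset.range (orderOf σ), (σ ^ i) x := by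
  rw [Algebra.norm_eq_prod_automorphisms]
  symm
  refine Finset.prod_bij (fun i _ => σ ^ i) (fun _ _ => Finset.mem_univ _)
    (fun i hi j hj h => pow_injOn_Iio_orderOf (by simpa using hi) (by simpa using hj) h)
    (fun τ _ => ?_) (fun _ _ => rfl)
  obtain ⟨i, rfl⟩ := mem_powers_iff_mem_zpowers.2 (hσ τ)
  exact ⟨i % orderOf σ, Finset.mem_range.2 (Nat.mod_lt _ (orderOf_pos σ)), pow_mod_orderOf σ i⟩

/-- Hilbert's Theorem 90 for a finite cyclic extension, in any universe. -/
theorem exists_eq_div_of_norm_eq_one {σ : K ≃ₐ[k] K} (hσ : ∀ τ, τ ∈ Subgroup.zpowers σ) {x : K}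
    (hx : Algebra.norm k x = 1) : ∃ y : K, y ≠ 0 ∧ x = y / σ y := by
  set n := orderOf σ with hn
  have hnpos : 0 < n := orderOf_pos σ
  let c : ℕ → K := fun i => ∏ j ∈ Finset.range i, (σ ^ j) x
  have hc0 : c 0 = 1 := by simp [c]
  have hcn : c n = 1 := by
    rw [← map_one (algebraMap k K), ← hx, norm_eq_prod_range_of_zpowers hσ]
  have hcs : ∀ i, c (i + 1) = x * σ (c i) := fun i => by
    simp only [c, Finset.prod_range_succ', map_prod, pow_zero, AlgEquiv.one_apply]
    rw [mul_comm]
    simp only [pow_succ', AlgEquiv.mul_apply]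
  -- A nonzero Lagrange resolvent exists by independence of the characters σ^i, since c 0 = 1.
  -- Applying σ and multiplying by x shifts its terms by one, and the ends agree because c n = c 0.
  obtain ⟨z, hz⟩ : ∃ z, ∑ i ∈ Finset.range n, c i * (σ ^ i) z ≠ 0 := by
    by_contra! H
    have hli := (linearIndependent_monoidHom K K).comp
      (fun i : Fin n => (((σ ^ (i : ℕ) : K ≃ₐ[k] K) : K →* K))) (fun i j hij => by
        refine Fin.ext (pow_injOn_Iio_orderOf (x := σ) i.2 j.2 ?_)
        ext y
        exact DFunLike.congr_fun hij y)
    have := Fintype.linearIndependent_iff.1 hli (fun i => c i) (by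
      funext y
      simpa [Finset.sum_range] using H y) ⟨0, hnpos⟩
    rw [hc0] at this
    exact one_ne_zero this
  refine ⟨_, hz, ?_⟩
  rw [eq_div_iff ((map_ne_zero σ).2 hz), map_sum, Finset.mul_sum]
  have h1 : ∀ i ∈ Finset.range n, x * σ (c i * (σ ^ i) z) = c (i + 1) * (σ ^ (i + 1)) z := by
    intro i _
    rw [map_mul, ← mul_assoc, ← hcs, pow_succ', AlgEquiv.mul_apply]
  rw [Finset.sum_congr rfl h1]
  have h2 := Finset.sum_range_succ (fun i => c i * (σ ^ i) z) n
  rw [Finset.sum_range_succ', hcn, hc0, hn, pow_orderOf_eq_one, pow_zero] at h2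
  exact add_right_cancel h2

end HilbertNinety

/-! ### The cyclotomic function field and its ring of integers A[l] -/

section CyclotomicField

variable {F : Type*} [Field F] [Fintype F] {w : F[X]}

instance : IsScalarTower F[X] (cyclotomicField w) (KAlg F) :=
  IsScalarTower.of_algebraMap_eq fun _ => rfl

instance : Module.IsTorsionFree F[X] (cyclotomicField w) :=
  Module.isTorsionFree_iff_algebraMap_injective.2
    (FunctionField.algebraMap_injective F (cyclotomicField w))

theorem coe_aeval (x : cyclotomicField w) (P : F[X][X]) :
    ((aeval x P : cyclotomicField w) : KAlg F) = aeval (x : KAlg F) P :=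
  (aeval_algebraMap_apply (KAlg F) x P).symm

theorem isIntegral_coe_iff {x : cyclotomicField w} :
    IsIntegral F[X] (x : KAlg F) ↔ IsIntegral F[X] x :=
  isIntegral_algebraMap_iff (algebraMap (cyclotomicField w) (KAlg F)).injective

theorem isGalois_and_finiteDimensional (hw : w.Monic) :
    IsGalois (RatFunc F) (cyclotomicField w) ∧
      FiniteDimensional (RatFunc F) (cyclotomicField w) := by
  have hsep : ((carlitzPoly w).map (algebraMap F[X] (RatFunc F))).Separable :=
    separable_map_carlitzPoly ((map_ne_zero_iff _ (IsFractionRing.injective _ _)).2 hw.ne_zero)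
  have hset : torsion w = ((carlitzPoly w).map (algebraMap F[X] (RatFunc F))).rootSet (KAlg F) := by
    ext x
    rw [mem_rootSet, aeval_map_algebraMap, aeval_carlitzPoly]
    exact ⟨fun h => ⟨hsep.ne_zero, h⟩, fun h => h.2⟩
  have hsplit : ((carlitzPoly w).map (algebraMap F[X] (RatFunc F))).IsSplittingField (RatFunc F)
      (cyclotomicField w) := by
    unfold cyclotomicField
    rw [hset]
    exact IntermediateField.adjoin_rootSet_isSplittingField (IsAlgClosed.splits _)
  have hfin := IsSplittingField.finiteDimensional (cyclotomicField w)
    ((carlitzPoly w).map (algebraMap F[X] (RatFunc F)))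
  exact ⟨IsGalois.of_separable_splitting_field hsep, hfin⟩

variable {x : cyclotomicField w}

theorem primitive_ne_zero' (hw : w.Monic) (hp : Prime w)
    (hx : IsPrimitiveTorsion w (x : KAlg F)) : x ≠ 0 := fun h =>
  primitive_ne_zero hw hp hx (by rw [h]; rfl)

theorem isIntegral_primitive (hw : w.Monic) (hx : IsPrimitiveTorsion w (x : KAlg F)) :
    IsIntegral F[X] x :=
  isIntegral_coe_iff.1 (isIntegral_of_mem_torsion hw hx.1)

theorem aeval_primitive_eq_zero (hw : w.Monic) (hp : Prime w)
    (hx : IsPrimitiveTorsion w (x : KAlg F)) : aeval x (carlitzQuot w) = 0 :=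
  Subtype.ext (by rw [coe_aeval, aeval_primitive_carlitzQuot hw hp hx]; rfl)

theorem minpoly_primitive (hw : w.Monic) (hp : Prime w)
    (hx : IsPrimitiveTorsion w (x : KAlg F)) :
    minpoly (RatFunc F) x = (carlitzQuot w).map (algebraMap F[X] (RatFunc F)) := by
  have hm := (carlitzQuot_natDegree_monic hw).2
  refine (minpoly.eq_of_irreducible_of_monic ?_ ?_ (hm.map _)).symm
  · exact (hm.irreducible_iff_irreducible_map_fraction_map).1 (irreducible_carlitzQuot hw hp hx)
  · rw [aeval_map_algebraMap, aeval_primitive_eq_zero hw hp hx]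

theorem minpoly_primitive' (hw : w.Monic) (hp : Prime w)
    (hx : IsPrimitiveTorsion w (x : KAlg F)) : minpoly F[X] x = carlitzQuot w := by
  have h := minpoly.isIntegrallyClosed_eq_field_fractions' (RatFunc F)
    (isIntegral_primitive hw hx)
  rw [minpoly_primitive hw hp hx] at h
  exact (map_injective _ (IsFractionRing.injective F[X] (RatFunc F)) h).symm

theorem adjoin_coe_primitive (hx : IsPrimitiveTorsion w (x : KAlg F)) :
    IntermediateField.adjoin (RatFunc F) {(x : KAlg F)} = cyclotomicField w := by
  apply le_antisymm
  · rw [IntermediateField.adjoin_simple_le_iff]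
    exact x.2
  · rw [IntermediateField.adjoin_le_iff]
    intro y hy
    obtain ⟨a, rfl⟩ := hx.2 y hy
    rw [← aeval_carlitzPoly, ← aeval_map_algebraMap (RatFunc F)]
    exact IntermediateField.algebra_adjoin_le_adjoin _ _ (aeval_mem_adjoin_singleton _ _)

theorem adjoin_primitive (hw : w.Monic) (hx : IsPrimitiveTorsion w (x : KAlg F)) :
    Algebra.adjoin (RatFunc F) {x} = ⊤ := by
  have := (isGalois_and_finiteDimensional hw).2
  have hint : IsIntegral (RatFunc F) x := Algebra.IsIntegral.isIntegral x
  rw [← IntermediateField.adjoin_simple_toSubalgebra_of_isAlgebraic hint.isAlgebraic,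
    ← IntermediateField.top_toSubalgebra]
  congr 1
  apply IntermediateField.map_injective (cyclotomicField w).val
  rw [IntermediateField.adjoin_map, Set.image_singleton]
  refine (adjoin_coe_primitive hx).trans ?_
  rw [← AlgHom.fieldRange_eq_map, IntermediateField.fieldRange_val]

/-- The power basis of `K_w` over `k` given by a primitive `w`-torsion point. -/
def primitivePowerBasis (hw : w.Monic) (hx : IsPrimitiveTorsion w (x : KAlg F)) :
    PowerBasis (RatFunc F) (cyclotomicField w) :=
  PowerBasis.ofAdjoinEqTop (isIntegral_primitive hw hx).tower_top (adjoin_primitive hw hx)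

theorem primitivePowerBasis_gen (hw : w.Monic) (hx : IsPrimitiveTorsion w (x : KAlg F)) :
    (primitivePowerBasis hw hx).gen = x :=
  PowerBasis.ofAdjoinEqTop_gen _ _

theorem finrank_cyclotomicField (hw : w.Monic) (hp : Prime w)
    (hx : IsPrimitiveTorsion w (x : KAlg F)) :
    Module.finrank (RatFunc F) (cyclotomicField w) = (carlitzQuot w).natDegree := by
  rw [(primitivePowerBasis hw hx).finrank, ← PowerBasis.natDegree_minpoly,
    primitivePowerBasis_gen, minpoly_primitive hw hp hx,
    (carlitzQuot_natDegree_monic hw).2.natDegree_map]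

theorem isIntegralUnit_prime_div_pow (hw : w.Monic) (hp : Prime w)
    (hx : IsPrimitiveTorsion w (x : KAlg F)) :
    IsIntegralUnit F[X]
      (algebraMap F[X] (cyclotomicField w) w / x ^ (carlitzQuot w).natDegree) := by
  refine ⟨div_ne_zero ?_ (pow_ne_zero _ (primitive_ne_zero' hw hp hx)), ?_, ?_⟩
  · exact (map_ne_zero_iff _ (FunctionField.algebraMap_injective F _)).2 hp.ne_zero
  · rw [← isIntegral_coe_iff]
    exact isIntegral_prime_div_pow hw hp hx
  · rw [← isIntegral_coe_iff]
    rw [inv_div]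
    exact isIntegral_pow_div_prime hw hp hx

theorem norm_primitive (hw : w.Monic) (hp : Prime w)
    (hx : IsPrimitiveTorsion w (x : KAlg F)) :
    Algebra.norm (RatFunc F) x =
      (-1) ^ (carlitzQuot w).natDegree * algebraMap F[X] (RatFunc F) w := by
  have hm := (carlitzQuot_natDegree_monic hw).2
  have h := Algebra.PowerBasis.norm_gen_eq_coeff_zero_minpoly (primitivePowerBasis hw hx)
  rw [primitivePowerBasis_gen, minpoly_primitive hw hp hx, coeff_map, coeff_zero_eq_eval_zero,
    eval_zero_carlitzQuot, ← (primitivePowerBasis hw hx).finrank,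
    finrank_cyclotomicField hw hp hx] at h
  exact h

/-- The ring of integers of `K_w` is `A[l]`. -/
theorem mem_adjoin_of_isIntegral (hw : w.Monic) (hp : Prime w)
    (hx : IsPrimitiveTorsion w (x : KAlg F)) {z : cyclotomicField w} (hz : IsIntegral F[X] z) :
    z ∈ Algebra.adjoin F[X] {x} := by
  obtain ⟨hgal, hfin⟩ := isGalois_and_finiteDimensional hw
  set B := primitivePowerBasis hw hx
  have hgen : B.gen = x := primitivePowerBasis_gen hw hx
  have hint : IsIntegral F[X] B.gen := by rw [hgen]; exact isIntegral_primitive hw hx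
  set N := (carlitzQuot w).natDegree with hN
  have hNpos : 0 < N := natDegree_carlitzQuot_pos hw hp
  -- Taking norms here shows that the discriminant of the power basis is w^(N-1) up to sign, so only
  -- a power of w can separate z from A[x].
  have hder : x * aeval x (derivative (carlitzQuot w)) = algebraMap F[X] _ w := by
    have := congrArg (aeval x) (X_mul_derivative_carlitzQuot w)
    simpa [aeval_primitive_eq_zero hw hp hx] using this
  have hdisc := Algebra.discr_powerBasis_eq_norm (RatFunc F) B
  have hnorm : Algebra.norm (RatFunc F) (aeval x (derivative (carlitzQuot w))) =
      (-1) ^ N * algebraMap F[X] (RatFunc F) w ^ (N - 1) := by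
    have h := congrArg (Algebra.norm (RatFunc F)) hder
    rw [map_mul, norm_primitive hw hp hx,
      IsScalarTower.algebraMap_apply F[X] (RatFunc F) (cyclotomicField w),
      Algebra.norm_algebraMap, finrank_cyclotomicField hw hp hx] at h
    have hw0 : algebraMap F[X] (RatFunc F) w ≠ 0 :=
      (map_ne_zero_iff _ (IsFractionRing.injective _ _)).2 hp.ne_zero
    have h1 : ((-1 : RatFunc F) ^ N) ^ 2 = 1 := by rw [← pow_mul, mul_comm, pow_mul]; simp
    obtain ⟨M, hM⟩ : ∃ M, N = M + 1 := ⟨N - 1, by omega⟩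
    rw [← hN] at h
    apply mul_left_cancel₀ hw0
    have h2 : algebraMap F[X] (RatFunc F) w ^ N =
        algebraMap F[X] (RatFunc F) w * algebraMap F[X] (RatFunc F) w ^ (N - 1) := by
      rw [← pow_succ', Nat.sub_add_cancel hNpos]
    rw [h2] at h
    linear_combination (-1) ^ N * h -
      algebraMap F[X] (RatFunc F) w * Algebra.norm (RatFunc F)
        (aeval x (derivative (carlitzQuot w))) * h1
  have hmem := Algebra.discr_mul_isIntegral_mem_adjoin (RatFunc F) hint hz
  rw [hdisc, hgen, minpoly_primitive hw hp hx, derivative_map, aeval_map_algebraMap, hnorm,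
    ← mul_assoc, ← pow_add] at hmem
  have hmem2 : w ^ (N - 1) • z ∈ Algebra.adjoin F[X] ({B.gen} : Set (cyclotomicField w)) := by
    rw [hgen, Algebra.smul_def]
    rw [Algebra.smul_def, map_mul, ← map_pow (algebraMap F[X] (RatFunc F)),
      ← IsScalarTower.algebraMap_apply, map_pow, map_neg, map_one, mul_assoc] at hmem
    rw [B.finrank] at hmem
    rcases neg_one_pow_eq_or (cyclotomicField w) (B.dim * (B.dim - 1) / 2 + N) with h | h
    · rwa [h, one_mul] at hmem
    · rw [h, neg_one_mul] at hmem
      simpa using neg_mem hmem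
  -- The Eisenstein property at w removes the remaining power of w.
  have := mem_adjoin_of_smul_prime_pow_smul_of_minpoly_isEisensteinAt (K := RatFunc F) hp hint hz
    hmem2 (by rw [hgen, minpoly_primitive' hw hp hx]; exact isEisensteinAt_carlitzQuot hw hp hx)
  rwa [hgen] at this

theorem carlitzQuot_dvd_of_aeval_eq_zero (hw : w.Monic) (hp : Prime w)
    (hx : IsPrimitiveTorsion w (x : KAlg F)) {P : F[X][X]} (h : aeval x P = 0) :
    carlitzQuot w ∣ P := by
  rw [← minpoly_primitive' hw hp hx]
  exact minpoly.isIntegrallyClosed_dvd (isIntegral_primitive hw hx) h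

theorem isIntegral_of_mem_adjoin (hw : w.Monic)
    (hx : IsPrimitiveTorsion w (x : KAlg F)) {z : cyclotomicField w}
    (hz : z ∈ Algebra.adjoin F[X] {x}) : IsIntegral F[X] z :=
  adjoin_le_integralClosure (isIntegral_primitive hw hx) hz

/-- Modulo p the derivative of C_w(X) is the nonzero constant w, so C_w(X) and its factor C_w(X)/X
are squarefree. -/
theorem squarefree_map_carlitzQuot {p : F[X]} (hp : Prime p) (h : ¬ p ∣ w) :
    Squarefree ((carlitzQuot w).map (Ideal.Quotient.mk (Ideal.span {p}))) := by
  have hmax : (Ideal.span {p}).IsMaximal :=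
    PrincipalIdealRing.isMaximal_of_irreducible hp.irreducible
  let _ := Ideal.Quotient.field (Ideal.span {p})
  have h0 : algebraMap F[X] (F[X] ⧸ Ideal.span {p}) w ≠ 0 := by
    rwa [Ideal.Quotient.algebraMap_eq, Ne, Ideal.Quotient.eq_zero_iff_mem,
      Ideal.mem_span_singleton]
  have hs := (separable_map_carlitzPoly (K := F[X] ⧸ Ideal.span {p}) h0).squarefree
  rw [← X_mul_carlitzQuot, Polynomial.map_mul] at hs
  exact hs.of_mul_right

theorem exists_isIntegral_eq_mul_of_pow_eq_mul (hw : w.Monic) (hp : Prime w)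
    (hx : IsPrimitiveTorsion w (x : KAlg F)) (n : ℕ) (p : F[X]) (hpp : Prime p) (hpw : ¬ p ∣ w)
    (z y : cyclotomicField w) (hz : IsIntegral F[X] z) (hy : IsIntegral F[X] y)
    (h : z ^ n = algebraMap F[X] _ p * y) :
    ∃ y', IsIntegral F[X] y' ∧ z = algebraMap F[X] _ p * y' := by
  obtain ⟨y', hy', he⟩ := exists_eq_mul_of_pow_eq_mul (aeval_primitive_eq_zero hw hp hx)
    (fun P => carlitzQuot_dvd_of_aeval_eq_zero hw hp hx) hpp (squarefree_map_carlitzQuot hpp hpw)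
    (mem_adjoin_of_isIntegral hw hp hx hz) (mem_adjoin_of_isIntegral hw hp hx hy) h
  exact ⟨y', isIntegral_of_mem_adjoin hw hx hy', he⟩

end CyclotomicField

/-! ### The Galois group as the unit group modulo w -/

section GaloisAction

variable {F : Type*} [Field F] [Fintype F] {w : F[X]} {x : cyclotomicField w}

theorem coe_aeval_carlitzPoly (a : F[X]) :
    ((aeval x (carlitzPoly a) : cyclotomicField w) : KAlg F) = carlitz F a (x : KAlg F) := by
  rw [coe_aeval, aeval_carlitzPoly]

theorem algEquiv_aeval (τ : cyclotomicField w ≃ₐ[RatFunc F] cyclotomicField w)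
    (P : F[X][X]) : τ (aeval x P) = aeval (τ x) P :=
  (aeval_algHom_apply ((τ : cyclotomicField w →ₐ[RatFunc F] cyclotomicField w).restrictScalars
    F[X]) x P).symm

theorem algEquiv_algebraMap (τ : cyclotomicField w ≃ₐ[RatFunc F] cyclotomicField w) (a : F[X]) :
    τ (algebraMap F[X] _ a) = algebraMap F[X] _ a :=
  ((τ : cyclotomicField w →ₐ[RatFunc F] cyclotomicField w).restrictScalars F[X]).commutes a

theorem IsIntegralUnit.algEquiv {y : cyclotomicField w}
    (hy : IsIntegralUnit F[X] y) (τ : cyclotomicField w ≃ₐ[RatFunc F] cyclotomicField w) :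
    IsIntegralUnit F[X] (τ y) :=
  hy.map ((τ : cyclotomicField w →ₐ[RatFunc F] cyclotomicField w).restrictScalars F[X])

theorem aeval_carlitzPoly_congr (hw : w.Monic) (hp : Prime w)
    (hx : IsPrimitiveTorsion w (x : KAlg F)) {a b : F[X]} :
    aeval x (carlitzPoly a) = aeval x (carlitzPoly b) ↔ w ∣ a - b := by
  rw [← carlitz_eq_zero_iff hw hp hx, map_sub, LinearMap.sub_apply, sub_eq_zero,
    ← coe_aeval_carlitzPoly, ← coe_aeval_carlitzPoly, Subtype.coe_inj]

theorem aeval_carlitzPoly_one : aeval x (carlitzPoly (1 : F[X])) = x :=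
  Subtype.ext (by rw [coe_aeval_carlitzPoly, map_one, Module.End.one_apply])

theorem exists_apply_primitive_eq (hw : w.Monic) (hp : Prime w)
    (hx : IsPrimitiveTorsion w (x : KAlg F))
    (τ : cyclotomicField w ≃ₐ[RatFunc F] cyclotomicField w) :
    ∃ a : F[X], ¬ w ∣ a ∧ τ x = aeval x (carlitzPoly a) := by
  have h0 : aeval (τ x) (carlitzQuot w) = 0 := by
    rw [← algEquiv_aeval, aeval_primitive_eq_zero hw hp hx, map_zero]
  have h1 : ((τ x : cyclotomicField w) : KAlg F) ∈ torsion w :=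
    (mem_torsion_iff _).2 (.inr (by rw [← coe_aeval, h0]; rfl))
  obtain ⟨a, ha⟩ := hx.2 _ h1
  refine ⟨a, fun h => ?_, Subtype.ext (by rw [coe_aeval_carlitzPoly, ha])⟩
  rw [carlitz_eq_zero_of_dvd hx.1 h] at ha
  have h2 : τ x = 0 := Subtype.ext ha.symm
  exact primitive_ne_zero' hw hp hx ((map_eq_zero τ).1 h2)

theorem exists_algEquiv_apply_primitive (hw : w.Monic) (hp : Prime w)
    (hx : IsPrimitiveTorsion w (x : KAlg F)) {a : F[X]} (ha : ¬ w ∣ a) :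
    ∃ σ : cyclotomicField w ≃ₐ[RatFunc F] cyclotomicField w,
      σ x = aeval x (carlitzPoly a) := by
  obtain ⟨hgal, hfin⟩ := isGalois_and_finiteDimensional hw
  refine minpoly.exists_algEquiv_of_root' (Algebra.IsAlgebraic.isAlgebraic x) ?_
  rw [minpoly_primitive hw hp hx, aeval_map_algebraMap]
  apply Subtype.ext
  rw [coe_aeval, coe_aeval_carlitzPoly]
  refine ((mem_torsion_iff _).1 (carlitz_mem_torsion hx.1 a)).resolve_left ?_
  rwa [carlitz_eq_zero_iff hw hp hx]

theorem pow_apply_primitive {σ : cyclotomicField w ≃ₐ[RatFunc F] cyclotomicField w} {g : F[X]}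
    (hσ : σ x = aeval x (carlitzPoly g)) (n : ℕ) :
    (σ ^ n) x = aeval x (carlitzPoly (g ^ n)) := by
  induction n with
  | zero => rw [pow_zero, pow_zero, aeval_carlitzPoly_one, AlgEquiv.one_apply]
  | succ n ih =>
    rw [pow_succ', AlgEquiv.mul_apply, ih, algEquiv_aeval, hσ]
    apply Subtype.ext
    rw [coe_aeval_carlitzPoly, coe_aeval_carlitzPoly, coe_aeval_carlitzPoly, pow_succ, carlitz_mul]

theorem algEquiv_ext_primitive (hw : w.Monic) (hx : IsPrimitiveTorsion w (x : KAlg F))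
    {σ τ : cyclotomicField w ≃ₐ[RatFunc F] cyclotomicField w} (h : σ x = τ x) : σ = τ := by
  have := (primitivePowerBasis hw hx).algHom_ext
    (f := (σ : cyclotomicField w →ₐ[RatFunc F] cyclotomicField w)) (g := (τ : _ →ₐ[_] _))
    (by rw [primitivePowerBasis_gen]; exact h)
  ext1 y
  exact DFunLike.congr_fun this y

theorem pow_eq_one_iff_dvd (hw : w.Monic) (hp : Prime w) (hx : IsPrimitiveTorsion w (x : KAlg F))
    {σ : cyclotomicField w ≃ₐ[RatFunc F] cyclotomicField w} {g : F[X]}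
    (hσ : σ x = aeval x (carlitzPoly g)) (n : ℕ) : σ ^ n = 1 ↔ w ∣ g ^ n - 1 := by
  rw [← aeval_carlitzPoly_congr hw hp hx, ← pow_apply_primitive hσ, aeval_carlitzPoly_one]
  exact ⟨fun h => by rw [h, AlgEquiv.one_apply], fun h => algEquiv_ext_primitive hw hx h⟩

theorem not_dvd_of_isPrimitiveRootMod {F : Type*} [Field F] {w g : F[X]} (hp : Prime w)
    (hg : IsPrimitiveRootMod w g) :
    ¬ w ∣ g := by
  obtain ⟨u, hu, -⟩ := hg
  intro h
  rw [Ideal.Quotient.eq_zero_iff_mem.2 (Ideal.mem_span_singleton.2 h)] at hu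
  have : Nontrivial (F[X] ⧸ Ideal.span {w}) := Ideal.Quotient.nontrivial_iff.2
    (fun h => hp.not_isUnit (Ideal.span_singleton_eq_top.1 h))
  exact u.ne_zero hu

theorem mem_zpowers_of_isPrimitiveRootMod (hw : w.Monic) (hp : Prime w)
    (hx : IsPrimitiveTorsion w (x : KAlg F)) {g : F[X]} (hg : IsPrimitiveRootMod w g)
    {σ : cyclotomicField w ≃ₐ[RatFunc F] cyclotomicField w}
    (hσ : σ x = aeval x (carlitzPoly g))
    (τ : cyclotomicField w ≃ₐ[RatFunc F] cyclotomicField w) : τ ∈ Subgroup.zpowers σ := by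
  have hfin := (isGalois_and_finiteDimensional hw).2
  obtain ⟨u, hu, hgen⟩ := hg
  have hmk : ∀ {a b : F[X]}, Ideal.Quotient.mk (Ideal.span {w}) a =
      Ideal.Quotient.mk (Ideal.span {w}) b ↔ w ∣ a - b := fun {a b} => by
    rw [Ideal.Quotient.eq, Ideal.mem_span_singleton]
  -- Finite order is inherited from σ; it allows natural exponents in place of integer ones.
  have hfo : IsOfFinOrder u := by
    refine isOfFinOrder_iff_pow_eq_one.2 ⟨orderOf σ, orderOf_pos σ, Units.ext ?_⟩
    rw [Units.val_pow_eq_pow_val, hu, ← map_pow, Units.val_one,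
      ← map_one (Ideal.Quotient.mk (Ideal.span {w})), hmk]
    exact (pow_eq_one_iff_dvd hw hp hx hσ _).1 (pow_orderOf_eq_one σ)
  obtain ⟨a, ha, hτ⟩ := exists_apply_primitive_eq hw hp hx τ
  obtain ⟨r, s, hrs⟩ := hp.irreducible.coprime_iff_not_dvd.2 ha
  have hs : Ideal.Quotient.mk (Ideal.span {w}) a * Ideal.Quotient.mk (Ideal.span {w}) s = 1 := by
    rw [← map_mul, ← map_one (Ideal.Quotient.mk (Ideal.span {w})), hmk]
    exact ⟨-r, by linear_combination hrs⟩
  obtain ⟨n, hn⟩ := hfo.mem_powers_iff_mem_zpowers.2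
    (hgen ⟨_, _, hs, by rw [mul_comm]; exact hs⟩)
  have hn' := congrArg Units.val hn
  simp only [Units.val_pow_eq_pow_val, hu, ← map_pow] at hn'
  refine ⟨n, ?_⟩
  change σ ^ (n : ℤ) = τ
  rw [zpow_natCast]
  apply algEquiv_ext_primitive hw hx
  rw [pow_apply_primitive hσ, hτ, aeval_carlitzPoly_congr hw hp hx]
  exact hmk.1 hn'

theorem orderOf_eq_natDegree (hw : w.Monic) (hp : Prime w)
    (hx : IsPrimitiveTorsion w (x : KAlg F))
    {σ : cyclotomicField w ≃ₐ[RatFunc F] cyclotomicField w}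
    (hσ : ∀ τ, τ ∈ Subgroup.zpowers σ) : orderOf σ = (carlitzQuot w).natDegree := by
  obtain ⟨hgal, hfin⟩ := isGalois_and_finiteDimensional hw
  rw [orderOf_eq_card_of_forall_mem_zpowers hσ, IsGalois.card_aut_eq_finrank,
    finrank_cyclotomicField hw hp hx]

end GaloisAction

/-! ### Congruences modulo the prime above w -/

section Congruence

variable {F : Type*} [Field F] [Fintype F] {w : F[X]} {x : cyclotomicField w}

theorem isIntegral_aeval_sub_div {R K : Type*} [CommRing R] [Field K] [Algebra R K] {t y : K}
    (hy : IsIntegral R y) (hyt : IsIntegral R (y / t)) (P : R[X]) :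
    IsIntegral R ((aeval y P - algebraMap R K (P.eval 0)) / t) := by
  have h := congrArg (aeval y) (X_mul_divX_add P)
  rw [map_add, map_mul, aeval_X, aeval_C, coeff_zero_eq_eval_zero] at h
  rw [← h, add_sub_cancel_right, mul_div_right_comm]
  exact hyt.mul (isIntegral_aeval hy _)

theorem isIntegral_aeval_primitive_sub_div (hw : w.Monic) (hp : Prime w)
    (hx : IsPrimitiveTorsion w (x : KAlg F)) (P : F[X][X]) :
    IsIntegral F[X] ((aeval x P - algebraMap F[X] _ (P.eval 0)) / x) := by
  have h0 := primitive_ne_zero' hw hp hx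
  refine isIntegral_aeval_sub_div (isIntegral_primitive hw hx) ?_ P
  rw [div_self h0]
  exact isIntegral_one

/-- The Galois group acts trivially modulo the prime above `w`. -/
theorem isIntegral_sub_apply_div (hw : w.Monic) (hp : Prime w)
    (hx : IsPrimitiveTorsion w (x : KAlg F))
    (τ : cyclotomicField w ≃ₐ[RatFunc F] cyclotomicField w) {y : cyclotomicField w}
    (hy : IsIntegral F[X] y) : IsIntegral F[X] ((y - τ y) / x) := by
  have h0 := primitive_ne_zero' hw hp hx
  have hmem := mem_adjoin_of_isIntegral hw hp hx hy
  rw [Algebra.adjoin_singleton_eq_range_aeval] at hmem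
  obtain ⟨Y, rfl⟩ := hmem
  obtain ⟨a, -, ha⟩ := exists_apply_primitive_eq hw hp hx τ
  have h1 := isIntegral_aeval_primitive_sub_div hw hp hx Y
  -- Both Y(x) and Y(τ x) are congruent to Y(0) modulo x, because τ x = C_a(x) is a multiple of x.
  have h2 := isIntegral_aeval_sub_div (t := x) (y := τ x)
    (by rw [ha]; exact isIntegral_aeval (isIntegral_primitive hw hx) _)
    (by
      rw [ha, ← X_mul_carlitzQuot, map_mul, aeval_X, mul_div_cancel_left₀ _ h0]
      exact isIntegral_aeval (isIntegral_primitive hw hx) _) Y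
  have h3 := h1.sub h2
  rw [← sub_div, sub_sub_sub_cancel_right, ← algEquiv_aeval] at h3
  exact h3

theorem isIntegral_algebraMap_div_iff (hw : w.Monic) (hp : Prime w)
    (hx : IsPrimitiveTorsion w (x : KAlg F)) (c : F[X]) :
    IsIntegral F[X] (algebraMap F[X] (cyclotomicField w) c / x) ↔ w ∣ c := by
  refine ⟨fun h => dvd_of_isIntegral_div_primitive hw hp hx (isIntegral_coe_iff.2 h), ?_⟩
  rintro ⟨c, rfl⟩
  have h0 := primitive_ne_zero' hw hp hx
  have h1 := (isIntegralUnit_prime_div_pow hw hp hx).isIntegral.mul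
    ((isIntegral_primitive hw hx).pow ((carlitzQuot w).natDegree - 1))
  obtain ⟨M, hM⟩ : ∃ M, (carlitzQuot w).natDegree = M + 1 :=
    ⟨_, (Nat.sub_add_cancel (natDegree_carlitzQuot_pos hw hp)).symm⟩
  rw [hM, Nat.add_sub_cancel, pow_succ, div_mul_eq_mul_div, mul_comm (x ^ M) x,
    mul_div_mul_right _ _ (pow_ne_zero _ h0)] at h1
  rw [map_mul, mul_div_right_comm]
  exact h1.mul isIntegral_algebraMap

/-- The elements d and τ d agree modulo x, and τ d is a unit. -/
theorem isIntegral_sub_one_div_of_eq_div (hw : w.Monic) (hp : Prime w)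
    (hx : IsPrimitiveTorsion w (x : KAlg F)) {e d : cyclotomicField w}
    (hd : IsIntegralUnit F[X] d) (τ : cyclotomicField w ≃ₐ[RatFunc F] cyclotomicField w)
    (h : e = d / τ d) : IsIntegral F[X] ((e - 1) / x) := by
  have hτ := hd.algEquiv τ
  have h1 := (isIntegral_sub_apply_div hw hp hx τ hd.isIntegral).mul hτ.isIntegral_inv
  rwa [div_mul_eq_mul_div, ← div_eq_mul_inv, sub_div, div_self hτ.ne_zero, ← h] at h1

end Congruence

/-! ### From the congruence to a quotient of conjugate units -/

section QuotientOfConjugates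

variable {F : Type*} [Field F] [Fintype F] {w : F[X]} {x : cyclotomicField w}

/-- An integral element which differs from each of its conjugates by a unit is, up to a unit,
the product of an element of `A` and a power of the primitive torsion point. -/
theorem exists_isIntegralUnit_div_of_forall (hw : w.Monic) (hp : Prime w)
    (hx : IsPrimitiveTorsion w (x : KAlg F)) {y : cyclotomicField w} (hy0 : y ≠ 0)
    (hy : IsIntegral F[X] y)
    (h : ∀ τ : cyclotomicField w ≃ₐ[RatFunc F] cyclotomicField w,
      IsIntegralUnit F[X] (y / τ y)) :
    ∃ (j : ℕ) (b : F[X]), b ≠ 0 ∧ IsIntegralUnit F[X] (y / (x ^ j * algebraMap F[X] _ b)) := by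
  obtain ⟨hgal, hfin⟩ := isGalois_and_finiteDimensional hw
  obtain ⟨n, hn⟩ := IsIntegrallyClosed.isIntegral_iff.1
    (Algebra.isIntegral_norm (RatFunc F) hy)
  have hn' : algebraMap F[X] (cyclotomicField w) n =
      ∏ τ : cyclotomicField w ≃ₐ[RatFunc F] cyclotomicField w, τ y := by
    rw [← Algebra.norm_eq_prod_automorphisms, ← hn, ← IsScalarTower.algebraMap_apply]
  have hn0 : n ≠ 0 := by
    rintro rfl
    rw [map_zero] at hn
    exact hy0 (Algebra.norm_eq_zero_iff.1 hn.symm)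
  refine exists_isIntegralUnit_div (natDegree_carlitzQuot_pos hw hp) hp
    (isIntegralUnit_prime_div_pow hw hp hx)
    (exists_isIntegral_eq_mul_of_pow_eq_mul hw hp hx _) n hn0 y hy ?_
  -- With n the norm of y, the quotient y^N/n is the product of all y/τ(y), hence a unit.
  rw [hn', ← finrank_cyclotomicField hw hp hx, ← IsGalois.card_aut_eq_finrank,
    Nat.card_eq_fintype_card, ← Finset.card_univ, ← Finset.prod_const, ← Finset.prod_div_distrib]
  exact IsIntegralUnit.prod fun τ _ => h τ

theorem exists_eq_div_of_isIntegral_sub_one_div (hw : w.Monic) (hp : Prime w)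
    (hx : IsPrimitiveTorsion w (x : KAlg F)) {g : F[X]} (hg : IsPrimitiveRootMod w g)
    {σ : cyclotomicField w ≃ₐ[RatFunc F] cyclotomicField w}
    (hσ : σ x = aeval x (carlitzPoly g)) {e : cyclotomicField w} (he : IsIntegralUnit F[X] e)
    (hnorm : Algebra.norm (RatFunc F) e = 1) (h : IsIntegral F[X] ((e - 1) / x)) :
    ∃ d, IsIntegralUnit F[X] d ∧ e = d / σ d := by
  obtain ⟨hgal, hfin⟩ := isGalois_and_finiteDimensional hw
  have hgen := mem_zpowers_of_isPrimitiveRootMod hw hp hx hg hσ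
  have hx0 := primitive_ne_zero' hw hp hx
  have hinj := FunctionField.algebraMap_injective F (cyclotomicField w)
  have hne : ∀ {r : F[X]}, r ≠ 0 → algebraMap F[X] (cyclotomicField w) r ≠ 0 := fun hr =>
    (map_ne_zero_iff _ hinj).2 hr
  obtain ⟨y, hy, hy0, hey⟩ : ∃ y, IsIntegral F[X] y ∧ y ≠ 0 ∧ e = y / σ y := by
    obtain ⟨y, hy0, hey⟩ := exists_eq_div_of_norm_eq_one hgen hnorm
    have halg : IsAlgebraic F[X] y :=
      (IsFractionRing.isAlgebraic_iff F[X] (RatFunc F) (cyclotomicField w)).2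
        (Algebra.IsAlgebraic.isAlgebraic y)
    obtain ⟨c, hc0, hc⟩ := halg.exists_integral_multiple
    rw [Algebra.smul_def] at hc
    refine ⟨_, hc, mul_ne_zero (hne hc0) hy0, ?_⟩
    rw [map_mul, algEquiv_algebraMap, mul_div_mul_left _ _ (hne hc0), hey]
  -- The quotient telescopes into a product of conjugates of e.
  have hpow : ∀ n : ℕ, IsIntegralUnit F[X] (y / (σ ^ n) y) := by
    intro n
    induction n with
    | zero =>
      rw [pow_zero, AlgEquiv.one_apply, div_self hy0]
      exact .one
    | succ n ih =>
      have h1 := ih.mul (he.algEquiv (σ ^ n))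
      rw [hey, map_div₀, ← AlgEquiv.mul_apply, ← pow_succ,
        div_mul_div_cancel₀ ((map_ne_zero (σ ^ n)).2 hy0)] at h1
      exact h1
  obtain ⟨j, b, hb, hd⟩ := exists_isIntegralUnit_div_of_forall hw hp hx hy0 hy fun τ => by
    obtain ⟨n, rfl⟩ := mem_powers_iff_mem_zpowers.2 (hgen τ)
    exact hpow n
  set d := y / (x ^ j * algebraMap F[X] _ b) with hd_def
  have hyd : y = x ^ j * algebraMap F[X] _ b * d := by
    rw [hd_def, mul_div_cancel₀ _ (mul_ne_zero (pow_ne_zero _ hx0) (hne hb))]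
  have hσd := hd.algEquiv σ
  set c := aeval x (carlitzQuot g)
  have hσx : σ x = x * c := by rw [hσ, ← X_mul_carlitzQuot, map_mul, aeval_X]
  have hrel : e * c ^ j * σ d = d := by
    have hy' := hey
    rw [eq_div_iff ((map_ne_zero σ).2 hy0), hyd, map_mul, map_mul, map_pow,
      algEquiv_algebraMap, hσx] at hy'
    apply mul_left_cancel₀ (mul_ne_zero (pow_ne_zero j hx0) (hne hb))
    linear_combination hy'
  -- Reduce `hrel` modulo x: e becomes 1, and the units d and σ d agree.
  have hc1 : IsIntegral F[X] ((c ^ j - 1) / x) := by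
    have h1 := ((isIntegral_sub_apply_div hw hp hx σ hd.isIntegral).sub
      (h.mul hσd.isIntegral)).mul (he.mul hσd).isIntegral_inv
    have h2 := he.ne_zero
    have h3 := hσd.ne_zero
    have h4 : (c ^ j - 1) / x = ((d - σ d) / x - (e - 1) / x * σ d) * (e * σ d)⁻¹ := by
      field_simp
      linear_combination hrel
    rwa [h4]
  -- Modulo x, c is the constant term g of C_g(X)/X.
  have hgj : w ∣ g ^ j - 1 := by
    rw [← isIntegral_algebraMap_div_iff hw hp hx]
    have h1 := isIntegral_aeval_primitive_sub_div hw hp hx (carlitzQuot g ^ j)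
    rw [map_pow, eval_pow, eval_zero_carlitzQuot] at h1
    have h2 := hc1.sub h1
    have h3 : algebraMap F[X] (cyclotomicField w) (g ^ j - 1) =
        c ^ j - 1 - (c ^ j - algebraMap F[X] (cyclotomicField w) (g ^ j)) := by
      rw [map_sub, map_one]
      ring
    rwa [h3, sub_div]
  rw [← pow_eq_one_iff_dvd hw hp hx hσ, ← orderOf_dvd_iff_pow_eq_one,
    orderOf_eq_natDegree hw hp hx hgen] at hgj
  obtain ⟨s, rfl⟩ := hgj
  have hv := (isIntegralUnit_prime_div_pow hw hp hx).pow s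
  -- Now j = N s, and x^j is w^s divided by the s-th power of the unit w/x^N. That power is absorbed
  -- into d, and the factor w^s b from A cancels.
  refine ⟨d / (algebraMap F[X] _ w / x ^ (carlitzQuot w).natDegree) ^ s, hd.div hv, ?_⟩
  have hys : y = algebraMap F[X] _ (w ^ s * b) *
      (d / (algebraMap F[X] _ w / x ^ (carlitzQuot w).natDegree) ^ s) := by
    have hw0 := hne hp.ne_zero
    rw [hyd, map_mul, map_pow, div_pow, ← pow_mul]
    field_simp
  rw [hey, hys, map_mul σ, algEquiv_algebraMap,
    mul_div_mul_left _ _ (hne (mul_ne_zero (pow_ne_zero _ hp.ne_zero) hb))]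

end QuotientOfConjugates

/-! ### The representing polynomial and its constant term -/

section Representation

variable {F : Type*} [Field F] [Fintype F] {w : F[X]} {x : cyclotomicField w}

theorem exists_represents (hw : w.Monic) (hp : Prime w)
    (hx : IsPrimitiveTorsion w (x : KAlg F)) (α : integers w) :
    ∃ P, Represents w (x : KAlg F) P α := by
  obtain ⟨h1, h2⟩ := carlitzQuot_natDegree_monic hw
  have hpos := natDegree_carlitzQuot_pos hw hp
  have hmem := mem_adjoin_of_isIntegral hw hp hx α.2
  rw [Algebra.adjoin_singleton_eq_range_aeval] at hmem
  obtain ⟨Y, hY⟩ := hmem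
  refine ⟨Y %ₘ carlitzQuot w, ?_, ?_⟩
  · have := natDegree_modByMonic_lt Y h2 (fun h => by rw [h, natDegree_one] at hpos; omega)
    omega
  · rw [← coe_aeval, ← hY]
    congr 1
    exact aeval_modByMonic_eq_self_of_root (aeval_primitive_eq_zero hw hp hx)

theorem represents_unique (hw : w.Monic) (hp : Prime w)
    (hx : IsPrimitiveTorsion w (x : KAlg F)) {α : integers w} {P Q : F[X][X]}
    (hP : Represents w (x : KAlg F) P α) (hQ : Represents w (x : KAlg F) Q α) : Q = P := by
  obtain ⟨h1, h2⟩ := carlitzQuot_natDegree_monic hw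
  have hpos := natDegree_carlitzQuot_pos hw hp
  have h3 : aeval x (Q - P) = 0 := by
    apply Subtype.ext
    rw [coe_aeval, map_sub, hQ.2, hP.2, sub_self]
    rfl
  have h4 := carlitzQuot_dvd_of_aeval_eq_zero hw hp hx h3
  rw [← sub_eq_zero]
  by_contra hne
  have h5 := natDegree_le_of_dvd h4 hne
  have h6 := natDegree_sub_le Q P
  have h7 := hP.1
  have h8 := hQ.1
  have h9 : max Q.natDegree P.natDegree ≤ Fintype.card F ^ w.natDegree - 2 := max_le h8 h7
  omega

/-- α = P(x) is congruent to P(0) modulo x, and an element of A is a multiple of x exactly when w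
divides it. -/
theorem dvd_eval_zero_sub_one_iff (hw : w.Monic) (hp : Prime w)
    (hx : IsPrimitiveTorsion w (x : KAlg F)) {α : integers w} {P : F[X][X]}
    (hP : Represents w (x : KAlg F) P α) :
    w ∣ P.eval 0 - 1 ↔ IsIntegral F[X] (((α : cyclotomicField w) - 1) / x) := by
  have hα : (α : cyclotomicField w) = aeval x P := Subtype.ext (by rw [coe_aeval, hP.2])
  have h := isIntegral_aeval_primitive_sub_div hw hp hx P
  rw [← isIntegral_algebraMap_div_iff hw hp hx, hα, map_sub, map_one]
  constructor <;> intro h'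
  · have := h.add h'
    rwa [← add_div, sub_add_sub_cancel] at this
  · have := h'.sub h
    rwa [← sub_div, sub_sub_sub_cancel_left] at this

end Representation

end CarlitzCyclotomic

end

/-! ### The main theorem -/

theorem mainTheorem4 {F : Type*} [Field F] [Fintype F]
    (w : F[X]) (hw_monic : w.Monic) (hw_prime : Prime w)
    (l : CarlitzCyclotomic.KAlg F) (hl : CarlitzCyclotomic.IsPrimitiveTorsion w l)
    (g : F[X]) (hg : CarlitzCyclotomic.IsPrimitiveRootMod w g)
    (ε : (CarlitzCyclotomic.integers w)ˣ)
    (hε : Algebra.norm (RatFunc F)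
      ((ε : CarlitzCyclotomic.integers w) : CarlitzCyclotomic.cyclotomicField w) = 1) :
    ∃ P : F[X][X],
      -- `P` is the unique polynomial representing `ε`
      CarlitzCyclotomic.Represents w l P ε ∧
      (∀ Q : F[X][X], CarlitzCyclotomic.Represents w l Q ε → Q = P) ∧
      -- `ε = δ / σ δ` for some unit `δ` and some `σ` in the Galois group iff `P(0) ≡ 1` mod `w`
      ((∃ (σ : CarlitzCyclotomic.cyclotomicField w ≃ₐ[RatFunc F]
              CarlitzCyclotomic.cyclotomicField w)
          (δ : (CarlitzCyclotomic.integers w)ˣ),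
          ((ε : CarlitzCyclotomic.integers w) : CarlitzCyclotomic.cyclotomicField w) =
            ((δ : CarlitzCyclotomic.integers w) : CarlitzCyclotomic.cyclotomicField w) /
              σ ((δ : CarlitzCyclotomic.integers w) : CarlitzCyclotomic.cyclotomicField w)) ↔
        w ∣ P.eval 0 - 1) ∧
      -- the same with `σ` the automorphism that sends `l` to `C_g(l)`
      ((∃ (σ : CarlitzCyclotomic.cyclotomicField w ≃ₐ[RatFunc F]
              CarlitzCyclotomic.cyclotomicField w)
          (δ : (CarlitzCyclotomic.integers w)ˣ),
          ((σ ⟨l, IntermediateField.subset_adjoin _ _ hl.1⟩ :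
              CarlitzCyclotomic.cyclotomicField w) : CarlitzCyclotomic.KAlg F) =
            CarlitzCyclotomic.carlitz F g l ∧
          ((ε : CarlitzCyclotomic.integers w) : CarlitzCyclotomic.cyclotomicField w) =
            ((δ : CarlitzCyclotomic.integers w) : CarlitzCyclotomic.cyclotomicField w) /
              σ ((δ : CarlitzCyclotomic.integers w) : CarlitzCyclotomic.cyclotomicField w)) ↔
        w ∣ P.eval 0 - 1) := by
  have hx : CarlitzCyclotomic.IsPrimitiveTorsion w
      ((⟨l, IntermediateField.subset_adjoin _ _ hl.1⟩ : CarlitzCyclotomic.cyclotomicField w) :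
        CarlitzCyclotomic.KAlg F) := hl
  set x : CarlitzCyclotomic.cyclotomicField w := ⟨l, IntermediateField.subset_adjoin _ _ hl.1⟩
  obtain ⟨P, hP⟩ := CarlitzCyclotomic.exists_represents hw_monic hw_prime hx ε
  have hdvd := CarlitzCyclotomic.dvd_eval_zero_sub_one_iff hw_monic hw_prime hx hP
  obtain ⟨σ, hσ⟩ := CarlitzCyclotomic.exists_algEquiv_apply_primitive hw_monic hw_prime hx
    (CarlitzCyclotomic.not_dvd_of_isPrimitiveRootMod hw_prime hg)
  -- The automorphism attached to g serves both equivalences; the opposite implications hold for an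
  -- arbitrary automorphism.
  have key : w ∣ P.eval 0 - 1 → ∃ δ : (CarlitzCyclotomic.integers w)ˣ,
      ((ε : CarlitzCyclotomic.integers w) : CarlitzCyclotomic.cyclotomicField w) =
        ((δ : CarlitzCyclotomic.integers w) : CarlitzCyclotomic.cyclotomicField w) /
          σ ((δ : CarlitzCyclotomic.integers w) : CarlitzCyclotomic.cyclotomicField w) := by
    intro h
    obtain ⟨d, hd, hed⟩ := CarlitzCyclotomic.exists_eq_div_of_isIntegral_sub_one_div hw_monic
      hw_prime hx hg hσ (CarlitzCyclotomic.IsIntegralUnit.of_unit ε) hε (hdvd.1 h)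
    obtain ⟨δ, rfl⟩ := hd.exists_unit
    exact ⟨δ, hed⟩
  refine ⟨P, hP, fun Q hQ => CarlitzCyclotomic.represents_unique hw_monic hw_prime hx hP hQ,
    ⟨?_, fun h => ⟨σ, key h⟩⟩, ?_, fun h => ?_⟩
  · rintro ⟨τ, δ, h⟩
    exact hdvd.2 (CarlitzCyclotomic.isIntegral_sub_one_div_of_eq_div hw_monic hw_prime hx
      (CarlitzCyclotomic.IsIntegralUnit.of_unit δ) τ h)
  · rintro ⟨τ, δ, -, h⟩
    exact hdvd.2 (CarlitzCyclotomic.isIntegral_sub_one_div_of_eq_div hw_monic hw_prime hx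
      (CarlitzCyclotomic.IsIntegralUnit.of_unit δ) τ h)
  · obtain ⟨δ, hδ⟩ := key h
    exact ⟨σ, δ, by rw [hσ, CarlitzCyclotomic.coe_aeval_carlitzPoly], hδ⟩
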